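/- A (finite, non-degenerate) cycle set is a finite set $X$ with a binary operation $\cdot$ such that $(x\cdot y)\cdot(x\cdot z)=(y\cdot x)\cdot(y\cdot z)$ for all $x,y,z\in X$, each map $\sigma_x\colon X\to X$, $y\mapsto x\cdot y$, is bijective, and the map $x\mapsto x\cdot x$ is bijective. Its permutation group is $\mathcal{G}(X)=\langle \sigma_x\mid x\in X\rangle\le \mathrm{Sym}_X$. The cycle set $X$ is indecomposable if it is not the disjoint union of two non-empty subsets that are closed under $\cdot$, and irretractable if the map $X\to\mathcal{G}(X)$, $x\mapsto\sigma_x^{-1}$, is injective. An isomorphism of cycle sets is a bijection that respects the operations. **Theorem.** Let $p$ be a prime and $\mathbb{Z}_p=\mathbb{Z}/p\mathbb{Z}$. Let $X$ be an indecomposable, irretractable cycle set of size $p^2$ such that $\mathcal{G}(X)$ is a $p$-group. Then $X$ is isomorphic to a cycle set of the form $\mathbb{Z}_p\times\mathbb{Z}_p$ with the multiplication $$(a,x)\cdot(b,y)=(b+x,\;y+\Phi(b-a)),$$ where $\Phi\colon\mathbb{Z}_p\to\mathbb{Z}_p$ is a non-constant map with $\Phi(A)=\Phi(-A)$ for all $A\in\mathbb{Z}_p$.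 Conversely, for every non-constant map $\Phi\colon\mathbb{Z}_p\to\mathbb{Z}_p$ with $\Phi(A)=\Phi(-A)$ for all $A\in\mathbb{Z}_p$, this multiplication makes $\mathbb{Z}_p\times\mathbb{Z}_p$ an indecomposable, irretractable cycle set (of size $p^2$) whose permutation group is a $p$-group. -/

import Mathlib

/-- A (non-degenerate) cycle set structure on `X`. Finiteness is imposed where it is used,
through the cardinality of `X`. -/
@[ext]
structure CycleSet (X : Type*) where
  /-- the binary operation, written `x · y` in the mathematical text -/
  op : X → X → X
  cycloid : ∀ x y z : X, op (op x y) (op x z) = op (op y x) (op y z)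
  bijective_left : ∀ x : X, Function.Bijective (op x)
  bijective_square : Function.Bijective (fun x : X => op x x)

namespace CycleSet

/-- The permutation `σ_x : y ↦ x · y`. -/
noncomputable def sigma {X : Type*} (C : CycleSet X) (x : X) : Equiv.Perm X :=
  Equiv.ofBijective (C.op x) (C.bijective_left x)

/-- The permutation group: the subgroup of `Sym(X)` generated by all `σ_x`. -/
def permutationGroup {X : Type*} (C : CycleSet X) : Subgroup (Equiv.Perm X) :=
  Subgroup.closure (Set.range C.sigma)

/-- The canonical map `π : x ↦ σ_x⁻¹` from `X` to its permutation group. -/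
noncomputable def retractionMap {X : Type*} (C : CycleSet X) (x : X) : C.permutationGroup :=
  ⟨(C.sigma x)⁻¹, C.permutationGroup.inv_mem (Subgroup.subset_closure (Set.mem_range_self x))⟩

/-- `X` is irretractable if `x ↦ σ_x⁻¹` is injective. -/
def Irretractable {X : Type*} (C : CycleSet X) : Prop :=
  Function.Injective C.retractionMap

/-- A subset closed under the cycle set operation. -/
def ClosedUnderOp {X : Type*} (C : CycleSet X) (S : Set X) : Prop :=
  ∀ x ∈ S, ∀ y ∈ S, C.op x y ∈ S

/-- `X` is indecomposable if it is not the disjoint union of two nonempty subsets which are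
closed under the operation. -/
def Indecomposable {X : Type*} (C : CycleSet X) : Prop :=
  ¬ ∃ X₁ X₂ : Set X, X₁.Nonempty ∧ X₂.Nonempty ∧ C.ClosedUnderOp X₁ ∧ C.ClosedUnderOp X₂ ∧
    Disjoint X₁ X₂ ∧ X₁ ∪ X₂ = Set.univ

/-- Two cycle sets are isomorphic if there is a bijection respecting the operations. -/
def Isomorphic {X Y : Type*} (C : CycleSet X) (D : CycleSet Y) : Prop :=
  ∃ e : X ≃ Y, ∀ x y : X, e (C.op x y) = D.op (e x) (e y)

end CycleSet

/-- The operation `(a, x) · (b, y) = (b + x, y + Φ (b - a))` on `ℤ_p × ℤ_p`. -/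
def zmodOp (p : ℕ) (Φ : ZMod p → ZMod p) (u v : ZMod p × ZMod p) : ZMod p × ZMod p :=
  (v.1 + u.2, v.2 + Φ (v.1 - u.1))

/-! The permutation group `G` of a finite cycle set carries a second, commutative addition: formal
sums of points are evaluated by `sumPerm`, and identifying sums of equal value gives an abelian
group `A` on which `G` acts, with `sumEquiv : A ≃ G` a twisted homomorphism (a brace).
Irretractability embeds `X` into `A`.

For a central `z` of order `p`, the `z`-orbits are `p` blocks of size `p`, permuted through a
homomorphism `χ : G → ℤ_p` (`IsPGroup.exists_hom_of_central`). A count of characters of `A` shows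
that `z x - x` is the same element of `A` for every `x` (`sumOf_sub_constant`), whence `σ_{z x} = r
σ_x` for a fixed `r`. A Fermat argument gives `χ r ≠ 0` (`not_stabilises_orbits`). So the block `β
x` and `s x = χ σ_x` are coordinates on `X`, and the cycle set law forces the formula. The converse
is direct computation. -/

namespace CycleSet

open Equiv

/-! ### The additive group structure on the permutation group. -/

section Additive

variable {X : Type*} (C : CycleSet X)

@[simp]
theorem sigma_apply (x y : X) : C.sigma x y = C.op x y := rfl

theorem sigma_op_mul_sigma (x y : X) :
    C.sigma (C.op x y) * C.sigma x = C.sigma (C.op y x) * C.sigma y := by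
  ext z
  exact C.cycloid x y z

theorem sigma_mem (x : X) : C.sigma x ∈ C.permutationGroup :=
  Subgroup.subset_closure (Set.mem_range_self x)

/-- This is the cycle set law at `g x` and `g y`; it makes evaluation independent of the order of
summands. -/
instance : LeftCommutative (fun (x : X) (g : Perm X) => C.sigma (g x) * g) where
  left_comm x y g := by
    simp only [Perm.mul_apply, sigma_apply, ← mul_assoc]
    rw [sigma_op_mul_sigma]

/-- The permutation attached to a formal sum of elements of a cycle set; it is determined by
`sumPerm (x ::ₘ m) = σ_{sumPerm m x} * sumPerm m`. -/
noncomputable def sumPerm (m : Multiset X) : Perm X :=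
  m.foldr (fun x g => C.sigma (g x) * g) 1

@[simp]
theorem sumPerm_zero : C.sumPerm 0 = 1 := rfl

@[simp]
theorem sumPerm_cons (x : X) (m : Multiset X) :
    C.sumPerm (x ::ₘ m) = C.sigma (C.sumPerm m x) * C.sumPerm m :=
  Multiset.foldr_cons _ _ _ _

@[simp]
theorem sumPerm_singleton (x : X) : C.sumPerm {x} = C.sigma x := by
  rw [← Multiset.cons_zero, sumPerm_cons]
  simp

theorem sumPerm_add (m n : Multiset X) :
    C.sumPerm (m + n) = C.sumPerm (n.map (C.sumPerm m)) * C.sumPerm m := by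
  induction n using Multiset.induction_on with
  | empty => simp
  | cons x n ih => simp [Multiset.add_cons, ih, mul_assoc]

theorem sumPerm_mem (m : Multiset X) : C.sumPerm m ∈ C.permutationGroup := by
  induction m using Multiset.induction_on with
  | empty => exact C.permutationGroup.one_mem
  | cons x m ih =>
    rw [sumPerm_cons]
    exact C.permutationGroup.mul_mem (C.sigma_mem _) ih

theorem exists_sumPerm_eq [Finite X] {g : Perm X} (hg : g ∈ C.permutationGroup) :
    ∃ m, C.sumPerm m = g := by
  have hmul : ∀ g h : Perm X, (∃ m, C.sumPerm m = g) → (∃ m, C.sumPerm m = h) →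
      ∃ m, C.sumPerm m = g * h := by
    rintro _ _ ⟨m, rfl⟩ ⟨n, rfl⟩
    -- Pulling `m` back along `sumPerm n` cancels the twist in `sumPerm_add`.
    refine ⟨n + m.map ((C.sumPerm n)⁻¹ : Perm X), ?_⟩
    rw [sumPerm_add, Multiset.map_map]
    simp
  induction hg using Subgroup.closure_induction with
  | mem g hg =>
    obtain ⟨x, rfl⟩ := hg
    exact ⟨{x}, C.sumPerm_singleton x⟩
  | one => exact ⟨0, rfl⟩
  | mul g h _ _ hg hh => exact hmul g h hg hh
  | inv g _ hg =>
    have hpow : ∀ n : ℕ, ∃ m, C.sumPerm m = g ^ n := by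
      intro n
      induction n with
      | zero => exact ⟨0, rfl⟩
      | succ n ih => exact pow_succ g n ▸ hmul _ _ ih hg
    obtain ⟨m, hm⟩ := hpow (orderOf g - 1)
    refine ⟨m, hm.trans (eq_inv_of_mul_eq_one_left ?_)⟩
    rw [← pow_succ, Nat.sub_add_cancel (orderOf_pos g), pow_orderOf_eq_one]

/-- Write `g = sumPerm k` and expand `k + m = m + k` both ways: one side is `sumPerm (m.map g) * g`,
the other depends on `m` only through `sumPerm m`. -/
theorem sumPerm_map_congr [Finite X] {g : Perm X} (hg : g ∈ C.permutationGroup)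
    {m n : Multiset X} (h : C.sumPerm m = C.sumPerm n) :
    C.sumPerm (m.map g) = C.sumPerm (n.map g) := by
  obtain ⟨k, rfl⟩ := C.exists_sumPerm_eq hg
  have h1 := C.sumPerm_add k m
  have h2 := C.sumPerm_add k n
  rw [add_comm, sumPerm_add, h, ← sumPerm_add, add_comm, h2] at h1
  exact (mul_right_cancel h1).symm

/-- Two formal sums are identified if they yield the same permutation. -/
noncomputable def sumCon : AddCon (Multiset X) where
  r m n := C.sumPerm m = C.sumPerm n
  iseqv := ⟨fun _ => rfl, Eq.symm, Eq.trans⟩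
  add' {m m' n n'} h h' := by
    rw [C.sumPerm_add m, h, ← C.sumPerm_add, add_comm, C.sumPerm_add n, h', ← C.sumPerm_add,
      add_comm]

theorem sumCon_mk_eq {m n : Multiset X} :
    (m : C.sumCon.Quotient) = n ↔ C.sumPerm m = C.sumPerm n :=
  C.sumCon.eq

/-- Undo the twist by acting with the inverse permutation. Cancellation and finiteness then supply
negatives. -/
theorem sumCon_add_left_cancel [Finite X] (a b c : C.sumCon.Quotient) (h : a + b = a + c) :
    b = c := by
  induction a using AddCon.induction_on with | _ k
  induction b using AddCon.induction_on with | _ m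
  induction c using AddCon.induction_on with | _ n
  rw [← AddCon.coe_add, ← AddCon.coe_add, sumCon_mk_eq, sumPerm_add, sumPerm_add,
    mul_left_inj] at h
  have := C.sumPerm_map_congr (C.permutationGroup.inv_mem (C.sumPerm_mem k)) h
  rw [Multiset.map_map, Multiset.map_map] at this
  rw [sumCon_mk_eq]
  simpa using this

/-- Evaluation of classes of formal sums in the permutation group. -/
noncomputable def sumEquiv [Finite X] : C.sumCon.Quotient ≃ C.permutationGroup :=
  Equiv.ofBijective
    (fun a => AddCon.liftOn a (fun m => (⟨C.sumPerm m, C.sumPerm_mem m⟩ : C.permutationGroup))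
      fun _ _ h => Subtype.ext h)
    ⟨fun a b h => by
      induction a using AddCon.induction_on with | _ m
      induction b using AddCon.induction_on with | _ n
      exact C.sumCon_mk_eq.2 (congrArg Subtype.val h), fun g => by
      obtain ⟨m, hm⟩ := C.exists_sumPerm_eq g.2
      exact ⟨m, Subtype.ext hm⟩⟩

instance [Finite X] : Finite C.sumCon.Quotient := Finite.of_equiv _ C.sumEquiv.symm

theorem exists_add_eq_zero [Finite X] (a : C.sumCon.Quotient) : ∃ b, b + a = 0 := by
  have : Function.Surjective (a + ·) :=
    Finite.surjective_of_injective fun b c h => C.sumCon_add_left_cancel a b c h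
  obtain ⟨b, hb⟩ := this 0
  exact ⟨b, (add_comm b a).trans hb⟩

noncomputable instance [Finite X] : Neg C.sumCon.Quotient :=
  ⟨fun a => (C.exists_add_eq_zero a).choose⟩

noncomputable instance [Finite X] : AddCommGroup C.sumCon.Quotient :=
  { (inferInstance : AddCommMonoid C.sumCon.Quotient) with
    zsmul := zsmulRec
    neg_add_cancel := fun a => (C.exists_add_eq_zero a).choose_spec }

/-- The action of the permutation group on classes of formal sums. -/
noncomputable def sumAction [Finite X] :
    C.permutationGroup →* AddMonoid.End C.sumCon.Quotient where
  toFun g := AddCon.lift C.sumCon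
    ((AddCon.mk' C.sumCon).comp (Multiset.mapAddMonoidHom (g : Perm X)))
    (fun _ _ h => C.sumCon_mk_eq.2 (C.sumPerm_map_congr g.2 h))
  map_one' := by
    ext a
    induction a using AddCon.induction_on with | _ m
    change ((m.map (1 : Perm X) : Multiset X) : C.sumCon.Quotient) = m
    simp
  map_mul' g h := by
    ext a
    induction a using AddCon.induction_on with | _ m
    change ((m.map (g * h : Perm X) : Multiset X) : C.sumCon.Quotient) =
      ((m.map (h : Perm X)).map (g : Perm X) : Multiset X)
    simp [Multiset.map_map]

theorem sumAction_coe [Finite X] (g : C.permutationGroup) (m : Multiset X) :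
    C.sumAction g (m : C.sumCon.Quotient) = (m.map (g : Perm X) : Multiset X) := rfl

/-- The class of an element of the cycle set. -/
noncomputable def sumOf (x : X) : C.sumCon.Quotient := (({x} : Multiset X) : C.sumCon.Quotient)

theorem sumAction_sumOf [Finite X] (g : C.permutationGroup) (x : X) :
    C.sumAction g (C.sumOf x) = C.sumOf ((g : Perm X) x) := by
  rw [sumOf, sumAction_coe, Multiset.map_singleton, sumOf]

theorem sumEquiv_sumOf [Finite X] (x : X) : (C.sumEquiv (C.sumOf x) : Perm X) = C.sigma x :=
  C.sumPerm_singleton x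

theorem sumEquiv_add [Finite X] (a b : C.sumCon.Quotient) :
    C.sumEquiv (a + b) = C.sumEquiv (C.sumAction (C.sumEquiv a) b) * C.sumEquiv a := by
  induction a using AddCon.induction_on with | _ m
  induction b using AddCon.induction_on with | _ n
  exact Subtype.ext (C.sumPerm_add m n)

theorem sumOf_induction [Finite X] {P : C.sumCon.Quotient → Prop} (zero : P 0)
    (add : ∀ x a, P a → P (C.sumOf x + a)) (a : C.sumCon.Quotient) : P a := by
  induction a using AddCon.induction_on with | _ m
  induction m using Multiset.induction_on with
  | empty => exact zero
  | cons x m ih => exact add x _ ih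

end Additive

end CycleSet

namespace CycleSet

open Equiv

/-! ### The cycle sets attached to even maps. -/

section Converse

variable {p : ℕ}

/-- The cycle set on `ℤ_p × ℤ_p` attached to an even map `Φ`. -/
def ofEven (Φ : ZMod p → ZMod p) (hΦ : ∀ A, Φ A = Φ (-A)) : CycleSet (ZMod p × ZMod p) where
  op := zmodOp p Φ
  cycloid := by
    rintro ⟨a, x⟩ ⟨b, y⟩ ⟨c, z⟩
    have h := hΦ (b - a)
    rw [neg_sub] at h
    ext
    · simp only [zmodOp, h]; ring
    · simp only [zmodOp, add_sub_add_right_eq_sub]; ring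
  bijective_left := by
    rintro ⟨a, x⟩
    refine Function.bijective_iff_has_inverse.2
      ⟨fun v => (v.1 - x, v.2 - Φ (v.1 - x - a)), fun v => ?_, fun v => ?_⟩ <;> ext <;>
      simp [zmodOp]
  bijective_square := by
    refine Function.bijective_iff_has_inverse.2
      ⟨fun v => (v.1 - (v.2 - Φ 0), v.2 - Φ 0), fun v => ?_, fun v => ?_⟩ <;> ext <;>
      simp [zmodOp]

variable (Φ : ZMod p → ZMod p) (hΦ : ∀ A, Φ A = Φ (-A))

theorem ofEven_sigma_apply (u v : ZMod p × ZMod p) :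
    (ofEven Φ hΦ).sigma u v = (v.1 + u.2, v.2 + Φ (v.1 - u.1)) := rfl

theorem ofEven_irretractable [Fact p.Prime] (hc : ¬ ∃ c, ∀ A, Φ A = c) :
    (ofEven Φ hΦ).Irretractable := by
  rintro ⟨a, x⟩ ⟨a', x'⟩ h
  have h1 : (ofEven Φ hΦ).sigma (a, x) = (ofEven Φ hΦ).sigma (a', x') :=
    inv_injective (congrArg Subtype.val h)
  have h2 : ∀ b, x = x' ∧ Φ (b - a) = Φ (b - a') := fun b => by
    have h3 := DFunLike.congr_fun h1 (b, 0)
    rw [ofEven_sigma_apply, ofEven_sigma_apply, Prod.mk.injEq] at h3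
    exact ⟨add_left_cancel h3.1, add_left_cancel h3.2⟩
  refine Prod.ext ?_ (h2 0).1
  by_contra hne
  have he : a - a' ≠ 0 := sub_ne_zero.2 hne
  -- `Φ` has the nonzero period `a - a'`, which generates `ℤ_p`.
  have hn : ∀ n : ℕ, Φ (n * (a - a')) = Φ 0 := by
    intro n
    induction n with
    | zero => simp
    | succ n ih =>
      rw [← ih, ← add_sub_cancel_right (n * (a - a')) a, (h2 _).2]
      congr 1
      push_cast
      ring
  refine hc ⟨Φ 0, fun A => ?_⟩
  rw [← hn (A / (a - a')).val, ZMod.natCast_zmod_val, div_mul_cancel₀ _ he]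

/-- If a subset and its complement are both closed under the operation, then the subset is stable
under the permutation group. -/
theorem mem_of_closed {X : Type*} [Finite X] (C : CycleSet X) {S T : Set X}
    (hS : C.ClosedUnderOp S) (hT : C.ClosedUnderOp T) (hd : Disjoint S T) (hu : S ∪ T = Set.univ)
    {g : Perm X} (hg : g ∈ C.permutationGroup) : ∀ x, g x ∈ S ↔ x ∈ S := by
  have key : ∀ {S T : Set X}, C.ClosedUnderOp S → C.ClosedUnderOp T → Disjoint S T →
      S ∪ T = Set.univ → ∀ u ∈ S, ∀ v, C.op u v ∈ S ↔ v ∈ S := by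
    intro S T hS hT hd hu u hus v
    refine ⟨fun h => ?_, fun h => hS u hus v h⟩
    -- By finiteness the injective map `σ_u` sends `S` onto itself.
    have hm : Set.MapsTo (C.op u) S S := hS u hus
    obtain ⟨w, hw⟩ := Finite.surjective_of_injective
      (hm.restrict_inj.2 (C.bijective_left u).1.injOn) ⟨_, h⟩
    exact (C.bijective_left u).1 (congrArg Subtype.val hw) ▸ w.2
  have hcompl : ∀ x, x ∈ T ↔ x ∉ S := fun x =>
    ⟨fun h h' => Set.disjoint_left.1 hd h' h, fun h =>
      ((Set.mem_union x S T).1 (hu ▸ Set.mem_univ x)).resolve_left h⟩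
  induction hg using Subgroup.closure_induction with
  | mem g hg =>
    obtain ⟨u, rfl⟩ := hg
    intro v
    by_cases hus : u ∈ S
    · exact key hS hT hd hu u hus v
    · have := key hT hS hd.symm (by rwa [Set.union_comm]) u ((hcompl u).2 hus) v
      rw [hcompl, hcompl, not_iff_not] at this
      exact this
  | one => exact fun _ => Iff.rfl
  | mul g h _ _ hg hh => exact fun x => (hg (h x)).trans (hh x)
  | inv g _ hg => exact fun x => by simpa using (hg (g⁻¹ x)).symm

theorem indecomposable_of_transitive {X : Type*} [Finite X] (C : CycleSet X)
    (h : ∀ x y, ∃ g ∈ C.permutationGroup, g x = y) : C.Indecomposable := by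
  rintro ⟨S, T, ⟨x, hx⟩, ⟨y, hy⟩, hS, hT, hd, hu⟩
  obtain ⟨g, hg, rfl⟩ := h x y
  exact Set.disjoint_left.1 hd ((C.mem_of_closed hS hT hd hu hg x).2 hx) hy

theorem Indecomposable.transitive {X : Type*} {C : CycleSet X} (hC : C.Indecomposable) (x y : X) :
    ∃ g ∈ C.permutationGroup, g x = y := by
  by_contra! hxy
  refine hC ⟨{z | ∃ g ∈ C.permutationGroup, g x = z}, {z | ¬ ∃ g ∈ C.permutationGroup, g x = z},
    ⟨x, 1, C.permutationGroup.one_mem, rfl⟩, ⟨y, by simpa using hxy⟩, ?_, ?_, ?_, ?_⟩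
  · rintro u - _ ⟨g, hg, rfl⟩
    exact ⟨C.sigma u * g, C.permutationGroup.mul_mem (C.sigma_mem u) hg, rfl⟩
  · rintro u - v hv ⟨g, hg, hgv⟩
    refine hv ⟨(C.sigma u)⁻¹ * g,
      C.permutationGroup.mul_mem (C.permutationGroup.inv_mem (C.sigma_mem u)) hg, ?_⟩
    rw [Perm.mul_apply, hgv, ← sigma_apply, Perm.inv_eq_iff_eq]
  · exact Set.disjoint_left.2 fun _ h h' => h' h
  · exact Set.union_compl_self _

theorem ofEven_indecomposable [Fact p.Prime] (hc : ¬ ∃ c, ∀ A, Φ A = c) :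
    (ofEven Φ hΦ).Indecomposable := by
  set C := ofEven Φ hΦ
  obtain ⟨a, ha⟩ : ∃ a, Φ (-a) - Φ 0 ≠ 0 := by
    by_contra! h
    exact hc ⟨Φ 0, fun A => by simpa [sub_eq_zero] using h (-A)⟩
  have hdiv : ∀ u u', C.sigma u * (C.sigma u')⁻¹ ∈ C.permutationGroup := fun u u' =>
    C.permutationGroup.mul_mem (C.sigma_mem u) (C.permutationGroup.inv_mem (C.sigma_mem u'))
  have hinv : ∀ u v, (C.sigma u)⁻¹ v = (v.1 - u.2, v.2 - Φ (v.1 - u.2 - u.1)) := fun u v => by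
    rw [Perm.inv_eq_iff_eq, ofEven_sigma_apply]
    ext <;> simp
  have hpow : ∀ (n : ℕ) (b y : ZMod p), ((C.sigma (a, 0) * (C.sigma (0, 0))⁻¹) ^ n) (b, y) =
      (b, y + n * (Φ (b - a) - Φ b)) := by
    intro n
    induction n with
    | zero => intro b y; simp
    | succ n ih =>
      intro b y
      rw [pow_succ, Perm.mul_apply, Perm.mul_apply, hinv, ofEven_sigma_apply]
      ext
      · simp [ih]
      · simp [ih]; ring
  apply C.indecomposable_of_transitive
  rintro ⟨b, y⟩ ⟨c, z⟩
  -- Horizontal moves are free; vertical moves are made over `0`, where the step `Φ (-a) - Φ 0` is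
  -- nonzero.
  have ht : ∀ (b c y : ZMod p), ∃ g ∈ C.permutationGroup, g (b, y) = (c, y) := fun b c y => by
    refine ⟨_, hdiv (0, c - b) (0, 0), ?_⟩
    rw [Perm.mul_apply, hinv, ofEven_sigma_apply]
    ext <;> simp
  obtain ⟨g, hg, hgb⟩ := ht b 0 y
  obtain ⟨k, hk, hkb⟩ := ht 0 c z
  refine ⟨k * ((C.sigma (a, 0) * (C.sigma (0, 0))⁻¹) ^ ((z - y) / (Φ (-a) - Φ 0)).val * g),
    C.permutationGroup.mul_mem hk (C.permutationGroup.mul_mem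
      (C.permutationGroup.pow_mem (hdiv _ _) _) hg), ?_⟩
  rw [Perm.mul_apply, Perm.mul_apply, hgb, hpow, ← hkb]
  congr 2
  simp [div_mul_cancel₀ _ ha]

theorem ofEven_isPGroup [NeZero p] : IsPGroup p (ofEven Φ hΦ).permutationGroup := by
  have hform : ∀ g ∈ (ofEven Φ hΦ).permutationGroup, ∃ (s : ZMod p) (f : ZMod p → ZMod p),
      ∀ b y, g (b, y) = (b + s, y + f b) := by
    intro g hg
    induction hg using Subgroup.closure_induction with
    | mem g hg =>
      obtain ⟨u, rfl⟩ := hg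
      exact ⟨u.2, fun b => Φ (b - u.1), fun b y => rfl⟩
    | one => exact ⟨0, 0, fun b y => by simp⟩
    | mul g h _ _ hg hh =>
      obtain ⟨s, f, hf⟩ := hg
      obtain ⟨t, k, hk⟩ := hh
      exact ⟨t + s, fun b => k b + f (b + t), fun b y => by
        rw [Perm.mul_apply, hk, hf]; simp [add_assoc]⟩
    | inv g _ hg =>
      obtain ⟨s, f, hf⟩ := hg
      exact ⟨-s, fun b => -f (b - s), fun b y => by
        rw [Perm.inv_eq_iff_eq, hf]; simp [sub_eq_add_neg]⟩
  have hpow : ∀ (g : Perm (ZMod p × ZMod p)) (s : ZMod p) (f : ZMod p → ZMod p),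
      (∀ b y, g (b, y) = (b + s, y + f b)) → ∀ n : ℕ, ∃ k : ZMod p → ZMod p,
      ∀ b y, (g ^ n) (b, y) = (b + n * s, y + k b) := by
    intro g s f hf n
    induction n with
    | zero => exact ⟨0, fun b y => by simp⟩
    | succ n ih =>
      obtain ⟨k, hk⟩ := ih
      refine ⟨fun b => k b + f (b + n * s), fun b y => ?_⟩
      rw [pow_succ', Perm.mul_apply, hk, hf]
      ext <;> simp <;> ring
  rintro ⟨g, hg⟩
  -- `g ^ p` fixes first coordinates and translates each fibre, so its `p`-th power is trivial.
  refine ⟨2, Subtype.ext ?_⟩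
  obtain ⟨s, f, hf⟩ := hform g hg
  obtain ⟨k, hk⟩ := hpow g s f hf p
  have hn : ∀ (n : ℕ) (b y : ZMod p), ((g ^ p) ^ n) (b, y) = (b, y + n * k b) := by
    intro n
    induction n with
    | zero => intro b y; simp
    | succ n ih =>
      intro b y
      rw [pow_succ', Perm.mul_apply, ih, hk]
      ext <;> simp
      ring
  ext1 ⟨b, y⟩
  change (g ^ p ^ 2) (b, y) = (b, y)
  rw [pow_two, pow_mul, hn]
  simp

end Converse

end CycleSet

/-! ### Blocks of a central element. -/

open scoped Pointwise in
open MulAction in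
/-- In a finite `p`-group acting faithfully and transitively on `p ^ 2` points, a central element
of order `p` has its orbits permuted by the group through a homomorphism onto `ℤ_p`. -/
theorem IsPGroup.exists_hom_of_central {p : ℕ} [Fact p.Prime] {G X : Type*} [Group G]
    [MulAction G X] [FaithfulSMul G X] [IsPretransitive G X] [Finite G] (hG : IsPGroup p G)
    (hX : Nat.card X = p ^ 2) {z : G} (hz : z ∈ Subgroup.center G) (hzp : orderOf z = p) :
    ∃ (χ : G →* Multiplicative (ZMod p)) (β : X → ZMod p), χ.ker.index = p ∧
      (∀ g x, β (g • x) = β x + (χ g).toAdd) ∧ Function.Surjective β ∧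
      ∀ x y, β x = β y → ∃ j : ℕ, y = z ^ j • x := by
  have hp : p.Prime := Fact.out
  have : Finite X := Nat.finite_of_card_ne_zero (by rw [hX]; exact pow_ne_zero _ hp.ne_zero)
  have : Nonempty X := (Nat.card_pos_iff.1 (by rw [hX]; exact pow_pos hp.pos _)).1
  obtain ⟨x₀⟩ := this
  have hcomm : ∀ g : G, Commute g z := fun g => Subgroup.mem_center_iff.1 hz g
  -- A central element fixing one point of a transitive action fixes all points.
  have hfree : ∀ g ∈ Subgroup.zpowers z, g • x₀ = x₀ → g = 1 := by
    rintro _ ⟨j, rfl⟩ hj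
    refine FaithfulSMul.eq_of_smul_eq_smul (α := X) fun x => ?_
    obtain ⟨g, rfl⟩ := exists_smul_eq G x₀ x
    change z ^ j • g • x₀ = _
    rw [smul_smul, ← ((hcomm g).zpow_right j).eq, ← smul_smul]
    simp only at hj
    rw [hj, one_smul]
  have : (Subgroup.zpowers z).Normal :=
    ⟨fun a ha g => by
      obtain ⟨j, rfl⟩ := ha
      simp only
      rw [((hcomm g).zpow_right j).eq, mul_inv_cancel_right]
      exact ⟨j, rfl⟩⟩
  set B := orbit (Subgroup.zpowers z) x₀
  have hB : IsBlock G B := IsBlock.orbit_of_normal x₀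
  have hx₀ : x₀ ∈ B := mem_orbit_self x₀
  have hBcard : B.ncard = p := by
    rw [← index_stabilizer, ← hzp, ← Nat.card_zpowers, ← Subgroup.index_bot]
    congr 1
    refine (Subgroup.eq_bot_iff_forall _).2 fun g hg => Subtype.ext (hfree g g.2 hg)
  have hmul := hB.ncard_block_mul_ncard_orbit_eq ⟨x₀, hx₀⟩
  rw [hBcard, hX, pow_two, ← index_stabilizer] at hmul
  have hindex : (stabilizer G B).index = p := Nat.eq_of_mul_eq_mul_left hp.pos hmul
  -- The index is the least prime dividing the group order.
  have hnormal : (stabilizer G B).Normal := by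
    apply Subgroup.normal_of_index_eq_minFac_card
    obtain ⟨n, hn⟩ := IsPGroup.iff_card.1 hG
    have : n ≠ 0 := by
      rintro rfl
      have := (stabilizer G B).index_dvd_card
      rw [hindex, hn, pow_zero] at this
      exact hp.one_lt.ne' (Nat.dvd_one.1 this)
    rw [hindex, hn, hp.pow_minFac this]
  have hcard : Nat.card (G ⧸ stabilizer G B) = p := hindex
  let e : G ⧸ stabilizer G B ≃* Multiplicative (ZMod p) :=
    mulEquivOfPrimeCardEq (p := p) hcard (by simp)
  let χ : G →* Multiplicative (ZMod p) := e.toMonoidHom.comp (QuotientGroup.mk' (stabilizer G B))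
  have hker : χ.ker = stabilizer G B := by
    ext g
    simp [χ]
  have hsurj : Function.Surjective χ := e.surjective.comp (QuotientGroup.mk'_surjective _)
  have hmem : ∀ g : G, g ∈ χ.ker ↔ g • x₀ ∈ B := fun g => by
    rw [hker, mem_stabilizer_iff]
    refine ⟨fun h => h ▸ Set.smul_mem_smul_set hx₀, fun h => ?_⟩
    exact hB.smul_eq_of_mem hx₀ h
  choose t ht using fun x : X => exists_smul_eq G x₀ x
  have hβ : ∀ g, χ (t (g • x₀)) = χ g := fun g => by
    have : g⁻¹ * t (g • x₀) ∈ χ.ker := by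
      rw [hmem, mul_smul, ht, inv_smul_smul]
      exact hx₀
    rw [MonoidHom.mem_ker, map_mul, map_inv, inv_mul_eq_one] at this
    exact this.symm
  refine ⟨χ, fun x => (χ (t x)).toAdd, hker ▸ hindex, fun g x => ?_, fun b => ?_, fun x y hxy => ?_⟩
  · obtain ⟨h, rfl⟩ := exists_smul_eq G x₀ x
    rw [smul_smul]
    simp only
    rw [hβ, hβ, map_mul, toAdd_mul, add_comm]
  · obtain ⟨g, hg⟩ := hsurj (Multiplicative.ofAdd b)
    exact ⟨g • x₀, by simp only; rw [hβ, hg, toAdd_ofAdd]⟩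
  · have h1 : (t x)⁻¹ * t y ∈ χ.ker := by
      rw [MonoidHom.mem_ker, map_mul, map_inv, inv_mul_eq_one]
      exact hxy
    obtain ⟨⟨g, hg⟩, hg'⟩ := (hmem _).1 h1
    obtain ⟨j, rfl⟩ := mem_powers_iff_mem_zpowers.2 hg
    refine ⟨j, ?_⟩
    change z ^ j • x₀ = ((t x)⁻¹ * t y) • x₀ at hg'
    rw [mul_smul, ht, eq_inv_smul_iff, smul_smul, ((hcomm _).pow_right j).eq, ← smul_smul,
      ht] at hg'
    exact hg'.symm

namespace CycleSet

/-! ### Characters of the additive group and constancy of `z x - x`. -/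

section Constancy

variable {X : Type*} {C : CycleSet X} [Finite X] {p : ℕ} [Fact p.Prime]

/-- Precomposition of a character with the action of `g`. -/
noncomputable def charComp (ψ : AddChar C.sumCon.Quotient ℂ) (g : C.permutationGroup) :
    AddChar C.sumCon.Quotient ℂ :=
  ψ.compAddMonoidHom (C.sumAction g)

@[simp]
theorem charComp_apply (ψ : AddChar C.sumCon.Quotient ℂ) (g : C.permutationGroup)
    (a : C.sumCon.Quotient) : charComp ψ g a = ψ (C.sumAction g a) := rfl

theorem sumAction_mul_apply (g h : C.permutationGroup) (a : C.sumCon.Quotient) :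
    C.sumAction (g * h) a = C.sumAction g (C.sumAction h a) := by
  rw [map_mul]; rfl

theorem sumAction_one_apply (a : C.sumCon.Quotient) : C.sumAction 1 a = a := by
  rw [map_one]; rfl

variable (C) in
/-- The difference operator `ψ ↦ ψ ∘ (z - 1)` on characters. -/
noncomputable def charDiff (z : C.permutationGroup) :
    AddChar C.sumCon.Quotient ℂ →* AddChar C.sumCon.Quotient ℂ where
  toFun ψ := charComp ψ z / ψ
  map_one' := by ext; simp
  map_mul' ψ φ := mul_div_mul_comm (charComp ψ z) (charComp φ z) ψ φ

theorem charDiff_apply (z : C.permutationGroup) (ψ : AddChar C.sumCon.Quotient ℂ)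
    (a : C.sumCon.Quotient) : charDiff C z ψ a = ψ (C.sumAction z a) / ψ a :=
  AddChar.div_apply' _ _ _

/-- The action of the permutation group on characters. -/
noncomputable instance : MulAction C.permutationGroup (AddChar C.sumCon.Quotient ℂ) where
  smul g ψ := charComp ψ g⁻¹
  one_smul ψ := by
    ext a
    change ψ (C.sumAction 1⁻¹ a) = ψ a
    rw [inv_one, sumAction_one_apply]
  mul_smul g h ψ := by
    ext a
    change ψ (C.sumAction (g * h)⁻¹ a) = ψ (C.sumAction h⁻¹ (C.sumAction g⁻¹ a))
    rw [mul_inv_rev, sumAction_mul_apply]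

theorem smul_char_apply (g : C.permutationGroup) (ψ : AddChar C.sumCon.Quotient ℂ)
    (a : C.sumCon.Quotient) : (g • ψ) a = ψ (C.sumAction g⁻¹ a) := rfl

theorem char_ext {ψ φ : AddChar C.sumCon.Quotient ℂ}
    (h : ∀ x, ψ (C.sumOf x) = φ (C.sumOf x)) : ψ = φ := by
  ext a
  induction a using C.sumOf_induction with
  | zero => simp
  | add x a ih => rw [AddChar.map_add_eq_mul, AddChar.map_add_eq_mul, ih, h]

theorem card_char : Nat.card (AddChar C.sumCon.Quotient ℂ) = Nat.card C.permutationGroup := by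
  have := Fintype.ofFinite C.sumCon.Quotient
  rw [Nat.card_eq_fintype_card, AddChar.card_eq, ← Nat.card_eq_fintype_card,
    Nat.card_congr C.sumEquiv]

theorem smul_charDiff {z : C.permutationGroup} (hz : z ∈ Subgroup.center C.permutationGroup)
    (g : C.permutationGroup) (ψ : AddChar C.sumCon.Quotient ℂ) :
    g • charDiff C z ψ = charDiff C z (g • ψ) := by
  ext a
  rw [smul_char_apply, charDiff_apply, charDiff_apply, smul_char_apply, smul_char_apply,
    ← sumAction_mul_apply, ← sumAction_mul_apply, Subgroup.mem_center_iff.1 hz]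

theorem sumOf_injective (hC : C.Irretractable) : Function.Injective C.sumOf := fun x y h =>
  hC (Subtype.ext (congrArg Inv.inv (by rw [← C.sumEquiv_sumOf, h, C.sumEquiv_sumOf])))

theorem charDiff_ne_one (hC : C.Irretractable) {z : C.permutationGroup} (hz1 : z ≠ 1) :
    ∃ ψ, charDiff C z ψ ≠ 1 := by
  obtain ⟨x, hx⟩ : ∃ x, (z : Equiv.Perm X) x ≠ x := by
    by_contra! h
    exact hz1 (Subtype.ext (Equiv.ext h))
  obtain ⟨ψ, hψ⟩ := AddChar.exists_apply_ne_zero.2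
    (sub_ne_zero.2 fun h => hx (sumOf_injective hC h))
  refine ⟨ψ, fun h => hψ ?_⟩
  rw [AddChar.map_sub_eq_div, ← sumAction_sumOf, ← charDiff_apply, h, AddChar.one_apply]

/-- Some nontrivial character of the form `ψ ∘ (z - 1)` is invariant under the group. -/
theorem exists_invariant_charDiff (hG : IsPGroup p C.permutationGroup) (hC : C.Irretractable)
    {z : C.permutationGroup} (hz : z ∈ Subgroup.center C.permutationGroup) (hz1 : z ≠ 1) :
    ∃ ψ, charDiff C z ψ ≠ 1 ∧ ∀ g : C.permutationGroup, g • charDiff C z ψ = charDiff C z ψ := by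
  let _ : MulAction C.permutationGroup (charDiff C z).range :=
    { smul := fun g φ => ⟨g • (φ : AddChar C.sumCon.Quotient ℂ), by
        obtain ⟨ψ, hψ⟩ := φ.2
        exact ⟨g • ψ, by rw [← hψ, smul_charDiff hz]⟩⟩
      one_smul := fun φ => Subtype.ext (one_smul _ _)
      mul_smul := fun g h φ => Subtype.ext (mul_smul _ _ _) }
  obtain ⟨n, hn⟩ := IsPGroup.iff_card.1 hG
  have hp : p.Prime := Fact.out
  have hdvd : p ∣ Nat.card (charDiff C z).range := by
    have h1 := (charDiff C z).range.card_subgroup_dvd_card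
    rw [card_char, hn] at h1
    obtain ⟨m, -, hm⟩ := (Nat.dvd_prime_pow hp).1 h1
    rw [hm]
    refine dvd_pow_self p fun h0 => ?_
    rw [h0, pow_zero, Subgroup.card_eq_one] at hm
    obtain ⟨ψ, hψ⟩ := charDiff_ne_one hC hz1
    exact hψ ((Subgroup.eq_bot_iff_forall _).1 hm _ ⟨ψ, rfl⟩)
  obtain ⟨⟨_, ψ, rfl⟩, hb, hne⟩ := hG.exists_fixed_point_of_prime_dvd_card_of_fixed_point
    (charDiff C z).range hdvd (a := 1) (fun g => Subtype.ext (by ext a; rfl))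
  exact ⟨ψ, fun h => hne (Subtype.ext h.symm), fun g => congrArg Subtype.val (hb g)⟩

theorem invariant_apply {φ : AddChar C.sumCon.Quotient ℂ}
    (hφ : ∀ g : C.permutationGroup, g • φ = φ) (g : C.permutationGroup) (a : C.sumCon.Quotient) :
    φ (C.sumAction g a) = φ a := by
  conv_lhs => rw [← hφ g]
  rw [smul_char_apply, ← sumAction_mul_apply, inv_mul_cancel, sumAction_one_apply]

/-- Invariance makes each application of `z` contribute the same factor. -/
theorem char_pow_apply (z : C.permutationGroup) {ψ : AddChar C.sumCon.Quotient ℂ}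
    (hψ : ∀ g : C.permutationGroup, g • charDiff C z ψ = charDiff C z ψ) (j : ℕ)
    (a : C.sumCon.Quotient) :
    ψ (C.sumAction (z ^ j) a) = ψ a * charDiff C z ψ a ^ j := by
  induction j with
  | zero => rw [pow_zero, sumAction_one_apply, pow_zero, mul_one]
  | succ j ih =>
    rw [pow_succ', sumAction_mul_apply, pow_succ, ← mul_assoc, ← ih,
      ← invariant_apply hψ (z ^ j) a, charDiff_apply, mul_div_cancel₀]
    exact (AddChar.val_isUnit _ _).ne_zero

/-- An invariant character `φ = ψ ∘ (z - 1)` is constant on `X` by transitivity. It suffices that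
`φ` generates the range of `charDiff`, since characters separate points of `A`. -/
theorem sumOf_sub_constant [Nonempty X] (hG : IsPGroup p C.permutationGroup)
    (hC : C.Irretractable) (hI : C.Indecomposable) {z : C.permutationGroup}
    (hz : z ∈ Subgroup.center C.permutationGroup) (hzp : orderOf z = p)
    {N : Subgroup C.permutationGroup} (hN : N.index = p)
    (hNz : ∀ n ∈ N, ∀ x, ∃ j : ℕ, (n : Equiv.Perm X) x = ((z ^ j : C.permutationGroup) :
      Equiv.Perm X) x) (x y : X) :
    C.sumOf ((z : Equiv.Perm X) x) - C.sumOf x = C.sumOf ((z : Equiv.Perm X) y) - C.sumOf y := by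
  have hp : p.Prime := Fact.out
  have hz1 : z ≠ 1 := fun h => hp.one_lt.ne (by rw [← hzp, h, orderOf_one])
  obtain ⟨ψ, hψ1, hψ⟩ := exists_invariant_charDiff hG hC hz hz1
  set φ := charDiff C z ψ with hφ
  obtain ⟨x₀⟩ := ‹Nonempty X›
  have hω : ∀ x, φ (C.sumOf x) = φ (C.sumOf x₀) := fun x => by
    obtain ⟨g, hg, rfl⟩ := hI.transitive x₀ x
    exact (congrArg φ (C.sumAction_sumOf ⟨g, hg⟩ x₀)).symm.trans (invariant_apply hψ _ _)
  set ω := φ (C.sumOf x₀)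
  have hω1 : ω ≠ 1 := fun h => hψ1 (char_ext fun x => by rw [hω, h, AddChar.one_apply])
  have hpow := char_pow_apply z hψ
  have hωp : ω ^ p = 1 := by
    have := hpow p (C.sumOf x₀)
    rw [← hzp, pow_orderOf_eq_one, sumAction_one_apply, hzp] at this
    exact (mul_eq_left₀ (AddChar.val_isUnit _ _).ne_zero).1 this.symm
  have hφp : φ ^ p = 1 := char_ext fun x => by
    rw [AddChar.pow_apply, hω, hωp, AddChar.one_apply]
  -- Sending `n` to `ψ ∘ n / ψ` embeds `N` in the kernel: where `n` acts as `z ^ j`, the value is `ω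
  -- ^ j`, which determines `j` mod `p`. Hence the range has order at most `p`.
  let f : N → (charDiff C z).ker := fun n => ⟨((n : C.permutationGroup)⁻¹ • ψ) / ψ, by
    rw [MonoidHom.mem_ker, map_div, ← smul_charDiff hz, hψ, div_self']⟩
  have hf : ∀ n x, (f n : AddChar C.sumCon.Quotient ℂ) (C.sumOf x) =
      ψ (C.sumOf (((n : C.permutationGroup) : Equiv.Perm X) x)) / ψ (C.sumOf x) := fun n x => by
    change (((n : C.permutationGroup)⁻¹ • ψ) / ψ) (C.sumOf x) = _
    rw [AddChar.div_apply', smul_char_apply, inv_inv, sumAction_sumOf]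
  have hfinj : Function.Injective f := fun n n' h => by
    refine Subtype.ext (Subtype.ext (Equiv.ext fun x => ?_))
    obtain ⟨j, hj⟩ := hNz n n.2 x
    obtain ⟨j', hj'⟩ := hNz n' n'.2 x
    have h1 := (hf n x).symm.trans ((by rw [h] : _ = _).trans (hf n' x))
    rw [hj, hj', ← sumAction_sumOf, ← sumAction_sumOf, hpow, hpow, ← hφ, hω,
      mul_div_cancel_left₀ _ (AddChar.val_isUnit _ _).ne_zero,
      mul_div_cancel_left₀ _ (AddChar.val_isUnit _ _).ne_zero,
      (isOfFinOrder_iff_pow_eq_one.2 ⟨p, hp.pos, hωp⟩).pow_eq_pow_iff_modEq,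
      orderOf_eq_prime hωp hω1, ← hzp, ← pow_eq_pow_iff_modEq] at h1
    rw [hj, hj', h1]
  have hrange : Nat.card (charDiff C z).range ≤ p := by
    have h1 := (charDiff C z).ker.card_mul_index
    rw [Subgroup.index_ker, card_char, ← N.card_mul_index, hN] at h1
    have h2 := Nat.card_le_card_of_injective f hfinj
    have h3 : 0 < Nat.card (charDiff C z).ker := Nat.card_pos
    refine Nat.le_of_mul_le_mul_left ?_ h3
    rw [h1]
    exact Nat.mul_le_mul_right p h2
  have hzpow : Subgroup.zpowers φ = (charDiff C z).range := by
    refine Subgroup.eq_of_le_of_card_ge ?_ ?_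
    · rw [Subgroup.zpowers_le]
      exact ⟨ψ, rfl⟩
    · rwa [Nat.card_zpowers, orderOf_eq_prime hφp hψ1]
  have hconst : ∀ ψ' x, charDiff C z ψ' (C.sumOf x) = charDiff C z ψ' (C.sumOf x₀) := by
    intro ψ' x
    obtain ⟨k, hk⟩ := mem_powers_iff_mem_zpowers.2
      (hzpow ▸ ⟨ψ', rfl⟩ : charDiff C z ψ' ∈ Subgroup.zpowers φ)
    rw [← hk]
    simp only
    rw [AddChar.pow_apply, AddChar.pow_apply, hω]
  by_contra hne
  obtain ⟨ψ', hψ'⟩ := AddChar.exists_apply_ne_zero.2 (sub_ne_zero.2 hne)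
  refine hψ' ?_
  rw [AddChar.map_sub_eq_div, AddChar.map_sub_eq_div, AddChar.map_sub_eq_div, ← sumAction_sumOf,
    ← sumAction_sumOf, ← charDiff_apply, ← charDiff_apply, hconst, hconst ψ' y]
  exact div_self (AddChar.val_isUnit _ _).ne_zero

theorem exists_sigma_central_apply [Nonempty X] (hG : IsPGroup p C.permutationGroup)
    (hC : C.Irretractable) (hI : C.Indecomposable) {z : C.permutationGroup}
    (hz : z ∈ Subgroup.center C.permutationGroup) (hzp : orderOf z = p)
    {N : Subgroup C.permutationGroup} (hN : N.index = p)
    (hNz : ∀ n ∈ N, ∀ x, ∃ j : ℕ, (n : Equiv.Perm X) x = ((z ^ j : C.permutationGroup) :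
      Equiv.Perm X) x) :
    ∃ r ∈ C.permutationGroup, ∀ x, C.sigma ((z : Equiv.Perm X) x) = r * C.sigma x := by
  obtain ⟨x₀⟩ := ‹Nonempty X›
  have : Nonempty X := ⟨x₀⟩
  set i := C.sumOf ((z : Equiv.Perm X) x₀) - C.sumOf x₀ with hi
  have hconst : ∀ x, C.sumOf ((z : Equiv.Perm X) x) - C.sumOf x = i := fun x =>
    sumOf_sub_constant hG hC hI hz hzp hN hNz x x₀
  -- As `z` is central, `g` carries the difference at `x₀` to that at `g x₀`. Invariance removes the
  -- twist in `sumEquiv_add`.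
  have hinv : ∀ g, C.sumAction g i = i := fun g => by
    have h := congrArg Subtype.val (Subgroup.mem_center_iff.1 hz g)
    have h' := DFunLike.congr_fun h x₀
    change (g : Equiv.Perm X) ((z : Equiv.Perm X) x₀) = (z : Equiv.Perm X) ((g : Equiv.Perm X) x₀)
      at h'
    rw [hi, map_sub, sumAction_sumOf, sumAction_sumOf, h', hconst]
  refine ⟨C.sumEquiv i, (C.sumEquiv i).2, fun x => ?_⟩
  rw [← sumEquiv_sumOf, ← sumEquiv_sumOf, ← sub_add_cancel (C.sumOf ((z : Equiv.Perm X) x))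
    (C.sumOf x), hconst, add_comm, sumEquiv_add, hinv]
  rfl

end Constancy

end CycleSet

namespace CycleSet

open Equiv

/-! ### Coordinates and the classification. -/

section Classification

variable {X : Type*} {C : CycleSet X} {p : ℕ} [Fact p.Prime]

theorem sigma_apply_eq_conj {z r : Perm X} (hz : ∀ u x, z (C.op u x) = C.op u (z x))
    (hr : ∀ x, C.sigma (z x) = r * C.sigma x) (w : X) :
    C.sigma (r w) = r * C.sigma w * r⁻¹ := by
  -- With `w · v = w`, the law for `z w` and `v` is compared with the law for `w` and `v`.
  obtain ⟨v, hv⟩ := (C.bijective_left w).2 w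
  have h := C.sigma_op_mul_sigma (z w) v
  have h1 : C.op (z w) v = r w := by
    rw [← sigma_apply, hr, Perm.mul_apply, sigma_apply, hv]
  rw [h1, hr, ← hz, hr, mul_assoc r, ← C.sigma_op_mul_sigma w v, hv, ← mul_assoc, ← mul_assoc,
    mul_left_inj] at h
  rw [← h, mul_inv_cancel_right]

/-- In the situation of `exists_sigma_central_apply`, the permutation `r` does not stabilise the
orbits of `z`. -/
theorem not_stabilises_orbits (hG : IsPGroup p C.permutationGroup)
    (hC : C.Irretractable) {z r : Perm X} (hz : ∀ u x, z (C.op u x) = C.op u (z x))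
    (hzp : orderOf z = p) (hrz : Commute r z)
    (hr : ∀ x, C.sigma (z x) = r * C.sigma x) : ¬ ∀ x, ∃ j : ℕ, r x = (z ^ j) x := by
  intro horb
  have hp : p.Prime := Fact.out
  have hz1 : z ≠ 1 := fun h => hp.one_lt.ne (by rw [← hzp, h, orderOf_one])
  have hinj : ∀ x y, C.sigma x = C.sigma y → x = y := fun x y h =>
    hC (Subtype.ext (congrArg Inv.inv h))
  have hr1 : r ≠ 1 := fun h => hz1 (Equiv.ext fun x =>
    hinj _ _ (by rw [hr, h, one_mul, Perm.one_apply]))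
  have hpow : ∀ (j : ℕ) x, C.sigma ((z ^ j) x) = r ^ j * C.sigma x := by
    intro j
    induction j with
    | zero => intro x; simp
    | succ j ih =>
      intro x
      rw [pow_succ, Perm.mul_apply, ih, hr, ← mul_assoc, ← pow_succ]
  have hconj := sigma_apply_eq_conj hz hr
  have hrp : r ^ p = 1 := by
    ext x
    obtain ⟨j, hj⟩ := horb x
    have : ∀ n : ℕ, (r ^ n) x = ((z ^ j) ^ n) x := by
      intro n
      induction n with
      | zero => rfl
      | succ n ih =>
        rw [pow_succ', Perm.mul_apply, ih, ← Perm.mul_apply,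
          ((hrz.pow_right j).pow_right n).eq, Perm.mul_apply, hj,
          ← Perm.mul_apply, ← pow_succ]
    rw [this, ← pow_mul, mul_comm, pow_mul, ← hzp, pow_orderOf_eq_one, one_pow]
  have hrord : orderOf r = p := orderOf_eq_prime hrp hr1
  refine hr1 (Equiv.ext fun w => ?_)
  obtain ⟨j, hj⟩ := horb w
  -- Two expressions for `σ_{r w}`: conjugation by `σ_w` raises `r` to the power `1 - j`.
  have h1 : r ^ j * C.sigma w = r * C.sigma w * r⁻¹ := by rw [← hpow, ← hj, hconj]
  have h2 : MulAut.conj (C.sigma w) r = r ^ (1 - j : ℤ) := by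
    rw [mul_assoc, ← inv_mul_eq_iff_eq_mul, ← mul_assoc, ← mul_inv_eq_iff_eq_mul.trans eq_comm,
      ← MulAut.conj_apply, map_inv, inv_eq_iff_eq_inv] at h1
    rw [h1, mul_inv_rev, inv_inv, zpow_sub, zpow_one, zpow_natCast,
      ((Commute.refl r).pow_left j).inv_left.eq]
  have h3 : ∀ n : ℕ, (MulAut.conj (C.sigma w) ^ n) r = r ^ ((1 - j : ℤ) ^ n) := by
    intro n
    induction n with
    | zero => simp
    | succ n ih => rw [pow_succ', MulAut.mul_apply, ih, map_zpow, h2, ← zpow_mul, pow_succ']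
  -- Since `σ_w` has `p`-power order, `(1 - j) ^ p ^ k = 1` mod `p`; Fermat gives `j = 0` mod `p`,
  -- so `r` fixes `w`.
  obtain ⟨k, hk⟩ := hG ⟨C.sigma w, C.sigma_mem w⟩
  have h4 := h3 (p ^ k)
  rw [← map_pow, show C.sigma w ^ p ^ k = 1 from congrArg Subtype.val hk] at h4
  have h5 : r ^ ((1 - j : ℤ) ^ p ^ k - 1) = 1 := by
    rw [zpow_sub, ← h4]
    simp
  rw [← orderOf_dvd_iff_zpow_eq_one, hrord, ← ZMod.intCast_zmod_eq_zero_iff_dvd] at h5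
  push_cast at h5
  rw [ZMod.pow_card_pow, sub_sub_cancel_left, neg_eq_zero, ZMod.natCast_eq_zero_iff, ← hzp,
    orderOf_dvd_iff_pow_eq_one] at h5
  rw [hj, h5]

theorem exists_isomorphic_zmodOp (hX : Nat.card X = p ^ 2) (hI : C.Indecomposable)
    (hC : C.Irretractable) (hG : IsPGroup p C.permutationGroup) :
    ∃ Φ : ZMod p → ZMod p, (¬ ∃ c, ∀ A, Φ A = c) ∧ (∀ A, Φ A = Φ (-A)) ∧
      ∃ e : X ≃ ZMod p × ZMod p, ∀ x y, e (C.op x y) = zmodOp p Φ (e x) (e y) := by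
  have hp : p.Prime := Fact.out
  have : Finite X := Nat.finite_of_card_ne_zero (by rw [hX]; exact pow_ne_zero _ hp.ne_zero)
  have : Nontrivial X := Finite.one_lt_card_iff_nontrivial.1
    (by rw [hX]; exact Nat.one_lt_pow two_ne_zero hp.one_lt)
  have : MulAction.IsPretransitive C.permutationGroup X := ⟨fun x y => by
    obtain ⟨g, hg, hgx⟩ := hI.transitive x y
    exact ⟨⟨g, hg⟩, hgx⟩⟩
  have : Nontrivial C.permutationGroup := by
    obtain ⟨x, y, hxy⟩ := exists_pair_ne X
    obtain ⟨g, hg⟩ := MulAction.exists_smul_eq C.permutationGroup x y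
    exact ⟨g, 1, fun h => hxy (by rw [← hg, h, one_smul])⟩
  have := hG.center_nontrivial
  obtain ⟨⟨z, hz⟩, hzp'⟩ :=
    exists_prime_orderOf_dvd_card' (G := Subgroup.center C.permutationGroup) p
    ((hG.to_subgroup _).card_eq_or_dvd.resolve_left Finite.one_lt_card.ne')
  have hzp : orderOf z = p := by rwa [Subgroup.orderOf_mk] at hzp'
  obtain ⟨χ, β, hker, hβ, hβs, horb⟩ := hG.exists_hom_of_central hX hz hzp
  have hker_orb : ∀ n ∈ χ.ker, ∀ x, ∃ j : ℕ, (n : Perm X) x =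
      ((z ^ j : C.permutationGroup) : Perm X) x := fun n hn x =>
    horb x (n • x) (by rw [hβ, MonoidHom.mem_ker.1 hn, toAdd_one, add_zero])
  obtain ⟨r, hr, hσ⟩ := exists_sigma_central_apply hG hC hI hz hzp hker hker_orb
  have hzop : ∀ u x, (z : Perm X) (C.op u x) = C.op u ((z : Perm X) x) := fun u x =>
    (DFunLike.congr_fun
      (congrArg Subtype.val (Subgroup.mem_center_iff.1 hz ⟨C.sigma u, C.sigma_mem u⟩)) x).symm
  set ε := (χ ⟨r, hr⟩).toAdd with hε
  have hε0 : ε ≠ 0 := fun h => by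
    refine not_stabilises_orbits hG hC hzop (by rwa [Subgroup.orderOf_coe])
      (congrArg Subtype.val (Subgroup.mem_center_iff.1 hz ⟨r, hr⟩)) hσ fun x => ?_
    exact hker_orb ⟨r, hr⟩ h x
  set s : X → ZMod p := fun x => (χ ⟨C.sigma x, C.sigma_mem x⟩).toAdd with hs
  have hsz : ∀ x, s ((z : Perm X) x) = s x + ε := fun x => by
    rw [add_comm, hs, hε, ← toAdd_mul, ← map_mul]
    exact congrArg (fun g => (χ g).toAdd) (Subtype.ext (hσ x))
  have hszpow : ∀ (j : ℕ) x, s (z ^ j • x) = s x + j * ε := by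
    intro j
    induction j with
    | zero => intro x; simp
    | succ j ih =>
      intro x
      rw [pow_succ', mul_smul]
      refine (hsz _).trans ?_
      rw [ih]
      push_cast
      ring
  have hβop : ∀ x y, β (C.op x y) = β y + s x := fun x y => hβ ⟨C.sigma x, C.sigma_mem x⟩ y
  -- Within a block, each `z` shifts `s` by `ε ≠ 0`.
  have hinj : Function.Injective fun x => (β x, s x) := by
    intro x y hxy
    obtain ⟨hb, hs'⟩ := Prod.mk.inj hxy
    obtain ⟨j, rfl⟩ := horb x y hb
    rw [hszpow, left_eq_add, mul_eq_zero, or_iff_left hε0, ZMod.natCast_eq_zero_iff, ← hzp,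
      orderOf_dvd_iff_pow_eq_one] at hs'
    rw [hs', one_smul]
  let e : X ≃ ZMod p × ZMod p := Equiv.ofBijective _
    ((Nat.bijective_iff_injective_and_card _).2 ⟨hinj, by
      rw [hX, Nat.card_prod, Nat.card_zmod, pow_two]⟩)
  -- This is `χ` applied to `sigma_op_mul_sigma`. With `hdep` it makes the increment a symmetric
  -- function of the two blocks.
  have hsymm : ∀ x y, s (C.op x y) - s y = s (C.op y x) - s x := fun x y => by
    have h : s (C.op x y) + s x = s (C.op y x) + s y := by
      simp only [hs]
      rw [← toAdd_mul, ← toAdd_mul, ← map_mul, ← map_mul]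
      exact congrArg (fun g => (χ g).toAdd) (Subtype.ext (C.sigma_op_mul_sigma x y))
    linear_combination h
  have hdep : ∀ x y y', β y = β y' → s (C.op x y) - s y = s (C.op x y') - s y' := by
    intro x y y' h
    obtain ⟨j, rfl⟩ := horb y y' h
    have : C.op x (z ^ j • y) = z ^ j • C.op x y := by
      clear h
      induction j with
      | zero => simp
      | succ j ih =>
        rw [pow_succ', mul_smul, mul_smul, ← ih]
        exact (hzop _ _).symm
    rw [this, hszpow, hszpow, add_sub_add_right_eq_sub]
  choose t ht using hβs
  let φ : ZMod p → ZMod p → ZMod p := fun a b => s (C.op (t a) (t b)) - s (t b)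
  have hφ : ∀ x y, s (C.op x y) = s y + φ (β x) (β y) := fun x y => by
    rw [← sub_eq_iff_eq_add', hdep x y (t (β y)) (ht _).symm, hsymm,
      hdep _ x (t (β x)) (ht _).symm, hsymm]
  have hφsymm : ∀ a b, φ a b = φ b a := fun a b => hsymm _ _
  have hcycle : ∀ a b c x y, φ (b + x) (c + x) + φ a c = φ (a + y) (c + y) + φ b c := by
    intro a b c x y
    have hβe : ∀ v, β (e.symm v) = v.1 := fun v => congrArg Prod.fst (e.apply_symm_apply v)
    have hse : ∀ v, s (e.symm v) = v.2 := fun v => congrArg Prod.snd (e.apply_symm_apply v)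
    have h := congrArg s (C.cycloid (e.symm (a, x)) (e.symm (b, y)) (e.symm (c, 0)))
    simp only [hφ, hβop, hβe, hse] at h
    linear_combination h
  -- The choice `a = 0`, `x = -b`, `y = 0` gives translation invariance; evenness then follows from
  -- symmetry.
  have hshift : ∀ b c, φ b c = φ 0 (c - b) := fun b c => by
    have h := hcycle 0 b c (-b) 0
    simp only [add_zero, add_neg_cancel, ← sub_eq_add_neg] at h
    linear_combination -h
  have hiso : ∀ x y, e (C.op x y) = zmodOp p (φ 0) (e x) (e y) := fun x y => by
    change (β (C.op x y), s (C.op x y)) = (β y + s x, s y + φ 0 (β y - β x))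
    rw [hβop, hφ, hshift]
  refine ⟨φ 0, fun ⟨c, hc⟩ => ?_, fun A => ?_, e, hiso⟩
  -- For constant `Φ` the permutation ignores the first coordinate, against irretractability.
  · have h : e.symm (0, 0) = e.symm (1, 0) := by
      refine hC (Subtype.ext (congrArg Inv.inv (Equiv.ext fun x => e.injective ?_)))
      rw [sigma_apply, sigma_apply, hiso, hiso]
      simp [zmodOp, hc]
    simpa using e.symm.injective h
  · rw [hφsymm 0 (-A), hshift (-A), zero_sub, neg_neg]

end Classification

end CycleSet

theorem mainTheorem5 (p : ℕ) (hp : p.Prime) :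
    (∀ (X : Type*) (C : CycleSet X), Nat.card X = p ^ 2 → C.Indecomposable → C.Irretractable →
      IsPGroup p C.permutationGroup →
        ∃ Φ : ZMod p → ZMod p, (¬ ∃ c, ∀ A, Φ A = c) ∧ (∀ A, Φ A = Φ (-A)) ∧
          ∃ D : CycleSet (ZMod p × ZMod p), D.op = zmodOp p Φ ∧ C.Isomorphic D) ∧
    (∀ Φ : ZMod p → ZMod p, (¬ ∃ c, ∀ A, Φ A = c) → (∀ A, Φ A = Φ (-A)) →
      ∃ D : CycleSet (ZMod p × ZMod p), D.op = zmodOp p Φ ∧ Nat.card (ZMod p × ZMod p) = p ^ 2 ∧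
        D.Indecomposable ∧ D.Irretractable ∧ IsPGroup p D.permutationGroup) := by
  have : Fact p.Prime := ⟨hp⟩
  refine ⟨fun X C hX hI hC hG => ?_, fun Φ hc hΦ => ?_⟩
  · obtain ⟨Φ, hc, hΦ, e, he⟩ := CycleSet.exists_isomorphic_zmodOp hX hI hC hG
    exact ⟨Φ, hc, hΦ, CycleSet.ofEven Φ hΦ, rfl, e, he⟩
  · exact ⟨CycleSet.ofEven Φ hΦ, rfl, by rw [Nat.card_prod, Nat.card_zmod, pow_two],
      CycleSet.ofEven_indecomposable Φ hΦ hc, CycleSet.ofEven_irretractable Φ hΦ hc,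
      CycleSet.ofEven_isPGroup Φ hΦ⟩
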